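/- Let $S_k=K_{1,k}$ be the star with $k$ edges and $P_3$ the path on three vertices. For a graph $\Gamma$, a $\Gamma$-design of order $v$ is a set $\mathcal B$ of subgraphs (blocks), all isomorphic to $\Gamma$, of a complete graph on $v$ vertices, whose edge sets partition the edge set of that complete graph. A down-link from a $\Gamma$-design $\mathcal B$ to a $\Gamma'$-design $\mathcal B'$ is a map $f:\mathcal B\to\mathcal B'$ such that $f(B)$ is a subgraph of $B$ for every $B\in\mathcal B$. Let $\mathcal L_1S_k(v)$ denote the set of all integers $n$ for which there exist an $S_k$-design of order $v$, a $P_3$-design of order $n$, and a down-link from the former to the latter (the vertex sets of the two designs may overlap arbitrarily). Theorem. Let $k>3$, $v\ge 4k$ and $v(v-1)\equiv 0\pmod{2k}$. Then \[\mathcal L_1S_k(v)=\{\,n\ge v-1 : n\equiv 0,1 \pmod 4\,\}.\] -/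

import Mathlib

/-- A graph whose vertices are elements of `α`: a vertex set `verts ⊆ α` together with a set of
edges between distinct elements of it. All blocks live in a common universe of vertices, so that
"being a subgraph" (`≤`) makes sense between blocks of different designs. -/
abbrev GraphIn (α : Type*) := (⊤ : SimpleGraph α).Subgraph

/-- The complete graph `K_V` with vertex set `V`. -/
def completeOn {α : Type*} (V : Set α) : GraphIn α :=
  (⊤ : GraphIn α).induce V

/-- The star `S_k`, i.e. the complete bipartite graph `K_{1,k}`. -/
abbrev starGraphK (k : ℕ) : SimpleGraph (Fin 1 ⊕ Fin k) :=
  completeBipartiteGraph (Fin 1) (Fin k)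

/-- The path `P_3` on three vertices. -/
abbrev pathP3 : SimpleGraph (Fin 3) := SimpleGraph.pathGraph 3

/-- `𝓑` is a `(K, Γ)`-design: a set of subgraphs of `K`, all isomorphic to `Γ`, whose edge sets
partition the edge set of `K`. -/
structure IsDesign {α W : Type*} (K : GraphIn α) (Γ : SimpleGraph W)
    (𝓑 : Set (GraphIn α)) : Prop where
  iso : ∀ B ∈ 𝓑, Nonempty (B.coe ≃g Γ)
  le : ∀ B ∈ 𝓑, B ≤ K
  existsUnique_block : ∀ e ∈ K.edgeSet, ∃! B : GraphIn α, B ∈ 𝓑 ∧ e ∈ B.edgeSet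

/-- `f` is a down-link from the design `𝓑` to the design `𝓑'`: it sends every block of `𝓑` to a
block of `𝓑'` which is a subgraph of it. -/
def IsDownLink {α : Type*} {𝓑 𝓑' : Set (GraphIn α)} (f : 𝓑 → 𝓑') : Prop :=
  ∀ B : 𝓑, (f B : GraphIn α) ≤ (B : GraphIn α)

/-- The set `𝓛₁Γ(v)` with respect to `Γ'`: all `n` such that some `Γ`-design of order `v` can be
down-linked to some `Γ'`-design of order `n`. The vertices of the designs are taken from `ℕ`; the
two vertex sets may overlap in any way. -/
def downLinkSpectrum₁ {W W' : Type*} (Γ : SimpleGraph W) (Γ' : SimpleGraph W') (v : ℕ) : Set ℕ :=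
  {n | ∃ (V V' : Finset ℕ) (𝓑 𝓑' : Set (GraphIn ℕ)),
    V.card = v ∧ V'.card = n ∧
    IsDesign (completeOn (V : Set ℕ)) Γ 𝓑 ∧
    IsDesign (completeOn (V' : Set ℕ)) Γ' 𝓑' ∧
    ∃ f : 𝓑 → 𝓑', IsDownLink f}

/-! Orientations reduce star decompositions to divisibility: if `k` divides every out-degree of a
tournament, cutting its out-neighbourhoods into `k`-sets yields an `S_k`-design.

Necessity: the edges fall into pairs, so `n.choose 2` is even. Of two vertices missed by the
`P_3`-design, one would be the centre of the star on their edge; but a `P_3` inside a star contains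
its centre.

Sufficiency: `exists_tournament_dvd` provides, through Landau's criterion, scores divisible by `k`
with a sink and a vertex of score `k`. Two leaves of each star are reserved for its image. The
tournament is carried over to `n` vertices, the sink being dropped if `n = v - 1`. Reversing
unreserved arcs makes all out-degrees even (`IsTournament.exists_even`), and the unreserved arcs
then pair off at their tails. This needs the unreserved edges to form a connected graph, which the
two special vertices ensure. -/

/-! ### Tournaments and Landau's criterion -/

/-- `E` lists the out-neighbours of a tournament on the vertex set `V`. -/
structure IsTournament (V : Finset ℕ) (E : ℕ → Finset ℕ) : Prop where
  mem : ∀ {a b}, b ∈ E a → a ∈ V ∧ b ∈ V ∧ a ≠ b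
  iff : ∀ {a b}, a ∈ V → b ∈ V → a ≠ b → (b ∈ E a ↔ a ∉ E b)

theorem IsTournament.asymm {V : Finset ℕ} {E : ℕ → Finset ℕ} (h : IsTournament V E) {a b : ℕ}
    (hab : b ∈ E a) : a ∉ E b := by
  obtain ⟨ha, hb, hne⟩ := h.mem hab
  exact (h.iff ha hb hne).1 hab

theorem IsTournament.sum_card {V : Finset ℕ} {E : ℕ → Finset ℕ} (h : IsTournament V E) :
    ∑ a ∈ V, (E a).card = V.card.choose 2 := by
  have h1 : ∑ a ∈ V, (E a).card = ∑ a ∈ V, ∑ b ∈ V, if b ∈ E a then 1 else 0 := by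
    refine Finset.sum_congr rfl fun a _ => ?_
    rw [← Finset.card_filter]
    congr 1
    ext b
    simp only [Finset.mem_filter]
    exact ⟨fun hb => ⟨(h.mem hb).2.1, hb⟩, fun hb => hb.2⟩
  -- Out-degrees plus in-degrees count every ordered pair of distinct vertices once.
  have h2 : ∑ a ∈ V, (E a).card + ∑ a ∈ V, (E a).card = V.offDiag.card := by
    conv_lhs => rw [h1]; rhs; rw [Finset.sum_comm]
    have hoff : V.offDiag = (V ×ˢ V).filter fun p => p.1 ≠ p.2 := by
      ext p
      simp only [Finset.mem_offDiag, Finset.mem_filter, Finset.mem_product]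
      tauto
    rw [← Finset.sum_add_distrib, hoff, Finset.card_filter, Finset.sum_product]
    refine Finset.sum_congr rfl fun a ha => ?_
    rw [← Finset.sum_add_distrib]
    refine Finset.sum_congr rfl fun b hb => ?_
    by_cases hab : a = b
    · subst hab
      have : a ∉ E a := fun h' => (h.mem h').2.2 rfl
      simp [this]
    · have := h.iff ha hb hab
      by_cases h' : a ∈ E b <;> simp_all
  rw [Finset.offDiag_card] at h2
  rw [Nat.choose_two_right, Nat.mul_sub, mul_one]
  omega

/-- A score function satisfying Landau's condition is the score function of a tournament. -/
theorem exists_tournament_of_scores (V : Finset ℕ) (s : ℕ → ℕ)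
    (hs : ∀ S ⊆ V, S.card.choose 2 ≤ ∑ x ∈ S, s x) (hV : ∑ x ∈ V, s x = V.card.choose 2) :
    ∃ D, IsTournament V D ∧ ∀ a ∈ V, (D a).card = s a := by
  classical
  -- Hall's theorem: each pair of vertices claims one of the `s x` tokens of one of its ends `x`,
  -- which becomes the tail. The pairs in `A` lie inside their union `U`, so Landau's condition for
  -- `U` is Hall's condition for `A`.
  let t : ↥(V.powersetCard 2) → Finset (Σ _ : ℕ, ℕ) :=
    fun e => e.1.sigma fun x => Finset.range (s x)
  have hall : ∀ A : Finset ↥(V.powersetCard 2), A.card ≤ (A.biUnion t).card := by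
    intro A
    set U : Finset ℕ := A.biUnion fun e => e.1 with hU
    have hUV : U ⊆ V := Finset.biUnion_subset.2 fun e _ => (Finset.mem_powersetCard.1 e.2).1
    have h1 : A.biUnion t = U.sigma fun x => Finset.range (s x) := by
      ext ⟨x, i⟩
      simp only [t, hU, Finset.mem_biUnion, Finset.mem_sigma]
      tauto
    have h2 : A.card ≤ (U.powersetCard 2).card := by
      rw [← Finset.card_image_of_injective A Subtype.val_injective]
      refine Finset.card_le_card fun e he => ?_
      obtain ⟨e', he', rfl⟩ := Finset.mem_image.1 he
      exact Finset.mem_powersetCard.2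
        ⟨Finset.subset_biUnion_of_mem (fun e : ↥(V.powersetCard 2) => e.1) he',
          (Finset.mem_powersetCard.1 e'.2).2⟩
    rw [h1, Finset.card_sigma]
    simp only [Finset.card_range]
    rw [Finset.card_powersetCard] at h2
    exact h2.trans (hs U hUV)
  obtain ⟨f, hf, hft⟩ := (Finset.all_card_le_biUnion_card_iff_exists_injective t).1 hall
  have hpair : ∀ {a b}, a ∈ V → b ∈ V → a ≠ b → ({a, b} : Finset ℕ) ∈ V.powersetCard 2 := by
    intro a b ha hb hab
    rw [Finset.mem_powersetCard]
    exact ⟨by simp [Finset.insert_subset_iff, ha, hb], Finset.card_pair hab⟩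
  let D : ℕ → Finset ℕ := fun a => V.filter fun b =>
    ∃ h : ({a, b} : Finset ℕ) ∈ V.powersetCard 2, (f ⟨_, h⟩).1 = a
  have hD : IsTournament V D := by
    constructor
    · intro a b hb
      obtain ⟨hb, h, -⟩ := Finset.mem_filter.1 hb
      rw [Finset.mem_powersetCard] at h
      refine ⟨h.1 (by simp), hb, ?_⟩
      rintro rfl
      simp at h
    · intro a b ha hb hab
      have h := hpair ha hb hab
      have h' := hpair hb ha hab.symm
      have hh : (⟨_, h⟩ : ↥(V.powersetCard 2)) = ⟨_, h'⟩ := Subtype.ext (Finset.pair_comm a b)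
      have hm := (Finset.mem_sigma.1 (hft ⟨_, h⟩)).1
      simp only [Finset.mem_insert, Finset.mem_singleton] at hm
      simp only [D, Finset.mem_filter, ha, hb, h, h', true_and, exists_true_left, ← hh]
      constructor
      · intro h1 h2
        exact hab (h1.symm.trans h2)
      · intro h2
        tauto
  refine ⟨D, hD, ?_⟩
  -- Injectivity only bounds the scores above; equality follows because the totals agree.
  have hle : ∀ a ∈ V, (D a).card ≤ s a := by
    intro a ha
    have hex : ∀ b ∈ D a, ∃ h : ({a, b} : Finset ℕ) ∈ V.powersetCard 2, (f ⟨_, h⟩).1 = a :=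
      fun b hb => (Finset.mem_filter.1 hb).2
    rw [← Finset.card_range (s a)]
    refine Finset.card_le_card_of_injOn
      (fun b => if h : ({a, b} : Finset ℕ) ∈ V.powersetCard 2 then (f ⟨_, h⟩).2 else 0) ?_ ?_
    · intro b hb
      obtain ⟨h, h1⟩ := hex b hb
      have h2 := (Finset.mem_sigma.1 (hft ⟨_, h⟩)).2
      rw [h1] at h2
      simpa [h] using h2
    · intro b hb c hc hbc
      obtain ⟨h, h1⟩ := hex b hb
      obtain ⟨h', h1'⟩ := hex c hc
      simp only [h, h', dif_pos] at hbc
      have h3 := hf (Sigma.ext (h1.trans h1'.symm) (heq_of_eq hbc))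
      have h4 : ({a, b} : Finset ℕ) = {a, c} := congrArg Subtype.val h3
      have h5 : b ∈ ({a, c} : Finset ℕ) := h4 ▸ (by simp)
      have hab := (hD.mem hb).2.2
      simp only [Finset.mem_insert, Finset.mem_singleton] at h5
      rcases h5 with h5 | h5
      · exact absurd h5.symm hab
      · exact h5
  exact (Finset.sum_eq_sum_iff_of_le hle).1 (hD.sum_card.trans hV.symm)

/-! ### Scores divisible by `k` -/

/-- Score function with a vertex of score `0`, a vertex of score `k`, and all other scores as equal
as possible among the multiples of `k`. -/
theorem exists_tournament_dvd {k v : ℕ} (hk : 0 < k) (hv : 2 * k + 2 ≤ v)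
    (hdiv : v * (v - 1) ≡ 0 [MOD 2 * k]) :
    ∃ D, IsTournament (Finset.range v) D ∧ (∀ a, k ∣ (D a).card) ∧ (D 0).card = k ∧
      D (v - 1) = ∅ := by
  obtain ⟨M, hM⟩ := (Nat.modEq_zero_iff_dvd).1 hdiv
  obtain ⟨L, rfl⟩ : ∃ L, v = L + 2 := ⟨v - 2, by omega⟩
  simp only [show L + 2 - 1 = L + 1 from rfl] at hM ⊢
  have hkL : 2 * k ≤ L := by omega
  have hM1 : 1 ≤ M := by
    rcases Nat.eq_zero_or_pos M with h | h
    · subst h; nlinarith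
    · exact h
  -- `M` is the number of stars. Vertex `0` takes one, and the other `M - 1` are spread evenly over
  -- the `L` middle vertices.
  obtain ⟨a, r, hr, har⟩ : ∃ a r, r < L ∧ M = a * L + r + 1 :=
    ⟨(M - 1) / L, (M - 1) % L, Nat.mod_lt _ (by omega), by
      have := Nat.div_add_mod' (M - 1) L; omega⟩
  have hL : (L + 2) * (L + 1) = 2 * k * (a * L + r + 1) := by rw [hM, har]
  have ha : 1 ≤ a := by
    rcases Nat.eq_zero_or_pos a with h | h
    · subst h; nlinarith
    · exact h
  let s : ℕ → ℕ := fun x =>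
    if x = 0 then k else if x = L + 1 then 0 else k * (a + if x ≤ r then 1 else 0)
  have hsdvd : ∀ x, k ∣ s x := by
    intro x; simp only [s]; split_ifs <;> simp
  set I := Finset.Ioo 0 (L + 1) with hI
  have hs_mid : ∀ x ∈ I, s x = k * (a + if x ≤ r then 1 else 0) := by
    intro x hx
    rw [hI, Finset.mem_Ioo] at hx
    simp only [s]
    rw [if_neg (by omega), if_neg (by omega)]
  have hIcard : I.card = L := by simp [hI]
  have hIsum : ∑ x ∈ I, s x = k * (a * L + r) := by
    rw [Finset.sum_congr rfl hs_mid, ← Finset.mul_sum, Finset.sum_add_distrib,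
      Finset.sum_const, hIcard, ← Finset.card_filter]
    have : I.filter (· ≤ r) = Finset.Icc 1 r := by
      ext x; simp [hI]; omega
    rw [this]; simp; left; ring
  -- Landau's condition for `U` enlarged by both special vertices, and by the sink alone.
  have hbound : ∀ U ⊆ I, (U.card + 2) * (U.card + 1) ≤ 2 * (∑ x ∈ U, s x) + 2 * k ∧
      (U.card + 1) * U.card ≤ 2 * ∑ x ∈ U, s x := by
    intro U hU
    set i := U.card with hi
    set T := ∑ x ∈ U, s x with hT
    have hiL : i ≤ L := by rw [← hIcard]; exact Finset.card_le_card hU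
    have hT1 : k * a * i ≤ T := by
      rw [hT, hi, mul_comm, ← smul_eq_mul, ← Finset.sum_const]
      refine Finset.sum_le_sum fun x hx => ?_
      rw [hs_mid x (hU hx)]
      exact Nat.mul_le_mul_left k (Nat.le_add_right _ _)
    have hT2 : k * (a * L + r) ≤ T + (L - i) * (k * (a + 1)) := by
      rw [← hIsum, ← Finset.sum_sdiff hU, add_comm, ← hT]
      refine Nat.add_le_add_left ?_ _
      rw [← hIcard, hi, ← Finset.card_sdiff_of_subset hU, ← smul_eq_mul, ← Finset.sum_const]
      refine Finset.sum_le_sum fun x hx => ?_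
      rw [hs_mid x (Finset.sdiff_subset hx)]
      refine Nat.mul_le_mul_left k ?_
      split_ifs <;> omega
    have hA : (i + 2) * (i + 1) ≤ 2 * T + 2 * k := by
      obtain ⟨h, rfl⟩ : ∃ h, L = i + h := ⟨L - i, by omega⟩
      rw [Nat.add_sub_cancel_left] at hT2
      zify at *
      -- Either `U` could avoid all the larger scores, and `hT1` suffices, or `hT2` is used.
      -- Multiplying by `L = i + h` lets `hL` rewrite the slack as a sum of nonnegative terms.
      by_cases hc : (r : ℤ) ≤ h
      · have h1 : (0:ℤ) ≤ (i + h) * (2 * k + 2 * (k * a * i) - (i + 2) * (i + 1)) := by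
          have e : (i + h) * (2 * k + 2 * (k * a * i) - (i + 2) * (i + 1) : ℤ)
              = i * ((i + h) * (h - r) + r * (i + h - 2 * k)) + 2 * (k - 1) * h := by
            linear_combination (-i : ℤ) * hL
          rw [e]
          have := mul_nonneg (by positivity : (0:ℤ) ≤ i + h) (sub_nonneg.2 hc)
          have := mul_nonneg (by positivity : (0:ℤ) ≤ r) (sub_nonneg.2 hkL)
          have : (0:ℤ) ≤ 2 * (k - 1) * h := by
            have : (0:ℤ) ≤ k - 1 := by linarith
            positivity
          have : (0:ℤ) ≤ i * ((i + h) * (h - r) + r * (i + h - 2 * k)) := by positivity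
          linarith
        have h2 := nonneg_of_mul_nonneg_right h1 (by linarith)
        linarith
      · push Not at hc
        have h1 : (0:ℤ) ≤ (i + h) * (2 * (i + h) + 3 - h - 2 * k * (a + 1)) := by
          have e : ((i + h) * (2 * (i + h) + 3 - h - 2 * k * (a + 1)) : ℤ)
              = (i + h) * (r - h) + (i + h - r) * (i + h - 2 * k) + 2 * (k - 1) := by
            linear_combination hL
          rw [e]
          have := mul_nonneg (by positivity : (0:ℤ) ≤ i + h) (sub_nonneg.2 hc.le)
          have := mul_nonneg (sub_nonneg.2 hr.le) (sub_nonneg.2 hkL)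
          linarith
        have h2 := nonneg_of_mul_nonneg_right h1 (by linarith)
        have h3 := mul_nonneg (by positivity : (0:ℤ) ≤ h) h2
        nlinarith
    refine ⟨hA, ?_⟩
    -- Dropping vertex `0` loses `2 * k` on one side and `2 * (i + 1)` on the other. For small `i`,
    -- scores of at least `k` are enough.
    by_cases hc : k ≤ i + 1
    · nlinarith
    · have : k * 1 * i ≤ k * a * i := by gcongr
      have : (i + 1) * i ≤ k * i := by gcongr; omega
      nlinarith
  have hV : Finset.range (L + 2) = insert 0 (insert (L + 1) I) := by
    ext x; simp [hI]; omega
  have hchoose : ∀ m N : ℕ, m * (m - 1) ≤ 2 * N → m.choose 2 ≤ N := by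
    intro m N h; rw [Nat.choose_two_right]; omega
  obtain ⟨D, hD, hDs⟩ := exists_tournament_of_scores (Finset.range (L + 2)) s (by
      intro S hS
      have hU := hbound (S ∩ I) Finset.inter_subset_right
      have hS' : S \ I ⊆ {0, L + 1} := by
        intro x hx
        rw [Finset.mem_sdiff] at hx
        have := hS hx.1
        rw [hV] at this
        simp only [Finset.mem_insert, Finset.mem_singleton] at this ⊢
        tauto
      have hsum : ∑ x ∈ S, s x = ∑ x ∈ S ∩ I, s x + ∑ x ∈ S \ I, s x :=
        (Finset.sum_inter_add_sum_sdiff S I s).symm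
      have hcard := Finset.card_inter_add_card_sdiff S I
      refine hchoose _ _ ?_
      by_cases h0 : 0 ∈ S
      · have : k ≤ ∑ x ∈ S \ I, s x :=
          (Finset.single_le_sum (f := s) (fun _ _ => Nat.zero_le _)
            (Finset.mem_sdiff.2 ⟨h0, by simp [hI]⟩) : s 0 ≤ _)
        have h2 := Finset.card_le_card hS'
        have h3 : ({0, L + 1} : Finset ℕ).card ≤ 2 := Finset.card_le_two
        have : S.card * (S.card - 1) ≤ ((S ∩ I).card + 2) * ((S ∩ I).card + 1) :=
          Nat.mul_le_mul (by omega) (by omega)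
        omega
      · have h2 : (S \ I).card ≤ ({L + 1} : Finset ℕ).card := by
          refine Finset.card_le_card fun x hx => ?_
          have h3 := hS' hx
          rw [Finset.mem_insert] at h3
          rcases h3 with rfl | h3
          · exact absurd (Finset.mem_sdiff.1 hx).1 h0
          · exact h3
        rw [Finset.card_singleton] at h2
        have : S.card * (S.card - 1) ≤ ((S ∩ I).card + 1) * (S ∩ I).card :=
          Nat.mul_le_mul (by omega) (by omega)
        omega) (by
      rw [hV, Finset.sum_insert (by simp [hI]), Finset.sum_insert (by simp [hI]), hIsum, ← hV,
        Finset.card_range, Nat.choose_two_right]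
      have h1 : s 0 = k := by simp [s]
      have h2 : s (L + 1) = 0 := by simp [s]
      rw [h1, h2, show L + 2 - 1 = L + 1 from rfl, hL]
      refine (Nat.div_eq_of_eq_mul_right (by norm_num) ?_).symm
      ring)
  refine ⟨D, hD, fun x => ?_, ?_, ?_⟩
  · by_cases hx : x ∈ Finset.range (L + 2)
    · rw [hDs x hx]; exact hsdvd x
    · have : D x = ∅ := Finset.eq_empty_of_forall_notMem fun y hy => hx (hD.mem hy).1
      simp [this]
  · rw [hDs 0 (by simp)]; simp [s]
  · rw [← Finset.card_eq_zero, hDs _ (by simp)]; simp [s]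

/-! ### Reorienting to even out-degrees -/

theorem Finset.exists_partition_card {α : Type*} [DecidableEq α] {k : ℕ} (s : Finset α)
    (h : k ∣ s.card) : ∃ P : Finset (Finset α), (∀ p ∈ P, p.card = k) ∧
      (P : Set (Finset α)).PairwiseDisjoint id ∧ P.sup id = s := by
  obtain ⟨m, hm⟩ := h
  induction m generalizing s with
  | zero =>
    refine ⟨∅, by simp, by simp, ?_⟩
    rw [mul_zero, Finset.card_eq_zero] at hm
    simp [hm]
  | succ m ih =>
    obtain ⟨t, hts, ht⟩ := Finset.exists_subset_card_eq (s := s) (n := k) (by rw [hm]; nlinarith)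
    obtain ⟨P, hP, hd, hsup⟩ := ih (s \ t) (by
      rw [Finset.card_sdiff_of_subset hts, hm, ht, mul_add, mul_one, Nat.add_sub_cancel])
    refine ⟨insert t P, ?_, ?_, ?_⟩
    · simpa [ht] using hP
    · rw [Finset.coe_insert, Set.pairwiseDisjoint_insert]
      refine ⟨hd, fun p hp _ => ?_⟩
      have : p ≤ s \ t := hsup ▸ Finset.le_sup (f := id) hp
      exact Finset.disjoint_sdiff.mono_right this
    · rw [Finset.sup_insert, hsup]
      exact Finset.union_sdiff_of_subset hts

/-- Reversing one arc of a tournament. -/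
theorem IsTournament.exists_flip {V : Finset ℕ} {E : ℕ → Finset ℕ} (hE : IsTournament V E)
    {C : ℕ → Finset ℕ} (hC : ∀ a, C a ⊆ E a) {x y : ℕ} (hyx : y ∈ E x) (hy : y ∉ C x) :
    ∃ E', IsTournament V E' ∧ (∀ a, C a ⊆ E' a) ∧ ∀ z, ((E' z).card : ZMod 2) =
      (E z).card + (if z = x then 1 else 0) + (if z = y then 1 else 0) := by
  obtain ⟨hxV, hyV, hne⟩ := hE.mem hyx
  have hxy := hE.asymm hyx
  refine ⟨fun a => if a = x then (E x).erase y else if a = y then insert x (E y) else E a,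
    ⟨?_, ?_⟩, ?_, ?_⟩
  · intro a b hb
    split_ifs at hb with h1 h2
    · subst h1; exact hE.mem (Finset.mem_of_mem_erase hb)
    · subst h2
      rcases Finset.mem_insert.1 hb with rfl | hb
      · exact ⟨hyV, hxV, hne.symm⟩
      · exact hE.mem hb
    · exact hE.mem hb
  · intro a b ha hb hab
    have := hE.iff ha hb hab
    split_ifs <;> simp_all
  · intro a b hb
    have := hC a hb
    dsimp only
    split_ifs with h1 h2
    · subst h1
      exact Finset.mem_erase.2 ⟨fun h => hy (h ▸ hb), this⟩
    · subst h2
      exact Finset.mem_insert_of_mem this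
    · exact this
  · intro z
    dsimp only
    split_ifs with h1 h2 h3
    · exact absurd (h1.symm.trans h2) hne
    · subst h1
      rw [Finset.card_erase_of_mem hyx, Nat.cast_sub (Finset.card_pos.2 ⟨y, hyx⟩), Nat.cast_one,
        add_zero, CharTwo.sub_eq_add]
    · subst h3
      rw [Finset.card_insert_of_notMem hxy]; push_cast; ring
    · simp

/-- A tournament can be reoriented, keeping the arcs in `C`, so that all out-degrees are even, if
the remaining edges form a connected graph. -/
theorem IsTournament.exists_even {V : Finset ℕ} {E : ℕ → Finset ℕ} (hE : IsTournament V E)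
    {C : ℕ → Finset ℕ} (hC : ∀ a, C a ⊆ E a) {w : ℕ} (hw : w ∈ V) (heven : Even (V.card.choose 2))
    (hconn : ∀ x ∈ V, Relation.ReflTransGen
      (fun a b => a ∈ V ∧ b ∈ V ∧ a ≠ b ∧ b ∉ C a ∧ a ∉ C b) x w) :
    ∃ E', IsTournament V E' ∧ (∀ a, C a ⊆ E' a) ∧ ∀ a, Even (E' a).card := by
  -- Reversing the edges of a walk from `x` to `w` changes parity only at its ends, since inner
  -- visits cancel.
  have hflip : ∀ x ∈ V, ∀ F, IsTournament V F → (∀ a, C a ⊆ F a) →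
      ∃ E', IsTournament V E' ∧ (∀ a, C a ⊆ E' a) ∧ ∀ z, ((E' z).card : ZMod 2) =
        (F z).card + (if z = x then 1 else 0) + (if z = w then 1 else 0) := by
    intro x hx
    have := hconn x hx
    clear hx
    induction this using Relation.ReflTransGen.head_induction_on with
    | refl =>
      intro F hF hCF
      refine ⟨F, hF, hCF, fun z => ?_⟩
      rw [add_assoc, CharTwo.add_self_eq_zero, add_zero]
    | head hab _ ih =>
      rename_i a b _
      intro F hF hCF
      obtain ⟨ha, hb, hne, h1, h2⟩ := hab
      obtain ⟨F₁, hF₁, hCF₁, h₁⟩ : ∃ E', IsTournament V E' ∧ (∀ a, C a ⊆ E' a) ∧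
          ∀ z, ((E' z).card : ZMod 2) =
            (F z).card + (if z = a then 1 else 0) + (if z = b then 1 else 0) := by
        by_cases h : b ∈ F a
        · exact hF.exists_flip hCF h h1
        · have h' : a ∈ F b := (hF.iff hb ha hne.symm).2 h
          obtain ⟨F', hF', hC', hz⟩ := hF.exists_flip hCF h' h2
          exact ⟨F', hF', hC', fun z => by rw [hz z]; ring⟩
      obtain ⟨F₂, hF₂, hCF₂, h₂⟩ := ih F₁ hF₁ hCF₁
      refine ⟨F₂, hF₂, hCF₂, fun z => ?_⟩
      rw [h₂ z, h₁ z, add_assoc _ (if z = b then (1 : ZMod 2) else 0) (if z = b then 1 else 0),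
        CharTwo.add_self_eq_zero, add_zero]
  have hall : ∀ S ⊆ V.erase w, ∃ E', IsTournament V E' ∧ (∀ a, C a ⊆ E' a) ∧
      ∀ a ∈ S, ((E' a).card : ZMod 2) = 0 := by
    intro S
    induction S using Finset.induction_on with
    | empty => exact fun _ => ⟨E, hE, hC, by simp⟩
    | insert x S hxS ih =>
      intro hS
      obtain ⟨F, hF, hCF, h⟩ := ih ((Finset.subset_insert _ _).trans hS)
      obtain ⟨hxw, hxV⟩ := Finset.mem_erase.1 (hS (Finset.mem_insert_self x S))
      by_cases h0 : ((F x).card : ZMod 2) = 0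
      · exact ⟨F, hF, hCF, by simpa [h0] using h⟩
      · obtain ⟨F', hF', hCF', h'⟩ := hflip x hxV F hF hCF
        refine ⟨F', hF', hCF', fun a ha => ?_⟩
        have haw := (Finset.mem_erase.1 (hS ha)).1
        rw [h' a, if_neg haw, add_zero]
        rcases Finset.mem_insert.1 ha with rfl | ha
        · rw [if_pos rfl]
          generalize ((F a).card : ZMod 2) = c at h0
          revert c
          decide
        · rw [if_neg (ne_of_mem_of_not_mem ha hxS), h a ha, add_zero]
  obtain ⟨F, hF, hCF, h⟩ := hall _ subset_rfl
  refine ⟨F, hF, hCF, fun a => ?_⟩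
  rw [even_iff_two_dvd, ← ZMod.natCast_eq_zero_iff]
  by_cases ha : a ∈ V
  · by_cases haw : a = w
    · subst haw
      have hs := congrArg (Nat.cast : ℕ → ZMod 2) hF.sum_card
      rw [(ZMod.natCast_eq_zero_iff _ 2).2 heven.two_dvd, Nat.cast_sum,
        ← Finset.add_sum_erase V _ ha, Finset.sum_eq_zero h, add_zero] at hs
      exact hs
    · exact h a (Finset.mem_erase.2 ⟨haw, ha⟩)
  · have : F a = ∅ := Finset.eq_empty_of_forall_notMem fun y hy => ha (hF.mem hy).1
    simp [this]

/-! ### Star blocks and designs from tournaments -/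

/-- The star with centre `c` and set of leaves `L`. -/
def starBlock (c : ℕ) (L : Finset ℕ) : GraphIn ℕ where
  verts := insert c (L : Set ℕ)
  Adj a b := a ≠ b ∧ (a = c ∧ b ∈ L ∨ b = c ∧ a ∈ L)
  adj_sub h := by simpa using h.1
  edge_vert := by
    rintro a b ⟨-, ⟨rfl, -⟩ | ⟨-, h⟩⟩
    · exact Set.mem_insert _ _
    · exact Set.mem_insert_of_mem _ h
  symm := ⟨fun a b h => ⟨h.1.symm, h.2.symm⟩⟩

theorem starBlock_mono {c : ℕ} {L L' : Finset ℕ} (h : L' ⊆ L) : starBlock c L' ≤ starBlock c L := by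
  refine ⟨Set.insert_subset_insert (by exact_mod_cast h), fun a b hab => ⟨hab.1, ?_⟩⟩
  exact hab.2.imp (fun h' => ⟨h'.1, h h'.2⟩) (fun h' => ⟨h'.1, h h'.2⟩)

theorem starBlock_iso {c k : ℕ} {L : Finset ℕ} (hc : c ∉ L) (hL : L.card = k) :
    Nonempty ((starBlock c L).coe ≃g starGraphK k) := by
  let e : Fin k ≃ L := (L.equivFinOfCardEq hL).symm
  let g : Fin 1 ⊕ Fin k → (starBlock c L).verts :=
    Sum.elim (fun _ => ⟨c, Set.mem_insert _ _⟩)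
      (fun i => ⟨e i, Set.mem_insert_of_mem _ (e i).2⟩)
  have hne : ∀ i, c ≠ (e i : ℕ) := fun i h => hc (h ▸ (e i).2)
  have hg : Function.Bijective g := by
    constructor
    · rintro (i | i) (j | j) h
      · exact congrArg _ (Subsingleton.elim _ _)
      · exact absurd (congrArg Subtype.val h) (hne j)
      · exact absurd (congrArg Subtype.val h).symm (hne i)
      · exact congrArg _ (e.injective (Subtype.ext (Subtype.mk.inj h)))
    · rintro ⟨x, hx⟩
      rcases hx with rfl | hx
      · exact ⟨Sum.inl 0, rfl⟩
      · refine ⟨Sum.inr (e.symm ⟨x, hx⟩), Subtype.ext ?_⟩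
        simp [g]
  refine ⟨(⟨Equiv.ofBijective g hg, ?_⟩ : starGraphK k ≃g (starBlock c L).coe).symm⟩
  have hmem : ∀ i, (e i : ℕ) ∈ L := fun i => (e i).2
  intro x y
  change (starBlock c L).Adj (g x) (g y) ↔ _
  rcases x with i | i <;> rcases y with j | j <;>
    simp [g, starBlock, hc, hne, hmem, (hne _).symm]

theorem starBlock_iso_path {c : ℕ} {L : Finset ℕ} (hc : c ∉ L) (hL : L.card = 2) :
    Nonempty ((starBlock c L).coe ≃g pathP3) := by
  obtain ⟨φ⟩ := starBlock_iso hc hL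
  let g : Fin 1 ⊕ Fin 2 → Fin 3 := Sum.elim (fun _ => 1) (fun i => if i = 0 then 0 else 2)
  have hg : Function.Bijective g := by decide
  refine ⟨φ.trans ⟨Equiv.ofBijective g hg, ?_⟩⟩
  intro a b
  change (SimpleGraph.pathGraph 3).Adj (g a) (g b) ↔ _
  rw [SimpleGraph.pathGraph_adj]
  change _ ↔ a.isLeft ∧ b.isRight ∨ a.isRight ∧ b.isLeft
  revert a b
  decide

/-- A tournament whose out-neighbourhoods are partitioned yields a decomposition into stars. -/
theorem IsTournament.isDesign {W : Type*} {Γ : SimpleGraph W} {V : Finset ℕ} {E : ℕ → Finset ℕ}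
    (hE : IsTournament V E) {Q : ℕ → Finset (Finset ℕ)}
    (hΓ : ∀ a, ∀ L ∈ Q a, Nonempty ((starBlock a L).coe ≃g Γ))
    (hne : ∀ a, ∀ L ∈ Q a, L.Nonempty)
    (hdisj : ∀ a, (Q a : Set (Finset ℕ)).PairwiseDisjoint id) (hsup : ∀ a, (Q a).sup id = E a) :
    IsDesign (completeOn (V : Set ℕ)) Γ {B | ∃ a, ∃ L ∈ Q a, B = starBlock a L} := by
  have hsub : ∀ a, ∀ L ∈ Q a, L ⊆ E a := fun a L hL => hsup a ▸ Finset.le_sup (f := id) hL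
  have hadj : ∀ a b, (completeOn (V : Set ℕ)).Adj a b ↔ a ∈ V ∧ b ∈ V ∧ a ≠ b := by
    intro a b
    simp [completeOn]
  refine ⟨?_, ?_, ?_⟩
  · rintro _ ⟨a, L, hL, rfl⟩
    exact hΓ a L hL
  · rintro _ ⟨a, L, hL, rfl⟩
    constructor
    · rintro x (rfl | hx)
      · obtain ⟨y, hy⟩ := hne x L hL
        exact (hE.mem (hsub x L hL hy)).1
      · exact (hE.mem (hsub a L hL hx)).2.1
    · rintro x y ⟨hxy, ⟨rfl, hy⟩ | ⟨rfl, hx⟩⟩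
      · exact (hadj _ _).2 (hE.mem (hsub x L hL hy))
      · obtain ⟨h1, h2, h3⟩ := hE.mem (hsub y L hL hx)
        exact (hadj _ _).2 ⟨h2, h1, h3.symm⟩
  -- An edge directed from `a` to `b` can only lie in a star centred at `a`.
  · have key : ∀ a b, b ∈ E a → ∃! B : GraphIn ℕ,
        B ∈ {B | ∃ a, ∃ L ∈ Q a, B = starBlock a L} ∧ s(a, b) ∈ B.edgeSet := by
      intro a b hb
      have hb' := hb
      rw [← hsup a, Finset.mem_sup] at hb'
      obtain ⟨L, hL, hbL⟩ := hb'
      refine ⟨starBlock a L, ⟨⟨a, L, hL, rfl⟩, ?_⟩, ?_⟩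
      · exact ⟨(hE.mem hb).2.2, Or.inl ⟨rfl, hbL⟩⟩
      · rintro _ ⟨⟨c, L', hL', rfl⟩, h⟩
        obtain ⟨-, ⟨rfl, h⟩ | ⟨rfl, h⟩⟩ := h
        · congr 1
          by_contra hLL
          exact Finset.disjoint_left.1 (hdisj a hL' hL hLL) h hbL
        · exact absurd (hsub b L' hL' h) (hE.asymm hb)
    intro e he
    induction e using Sym2.ind with
    | _ a b =>
      obtain ⟨ha, hb, hab⟩ := (hadj a b).1 he
      by_cases h : b ∈ E a
      · exact key a b h
      · rw [Sym2.eq_swap]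
        exact key b a ((hE.iff hb ha hab.symm).2 h)

/-! ### Necessary conditions -/

theorem SimpleGraph.Subgraph.ncard_edgeSet_of_iso {α W : Type*} {G : SimpleGraph α}
    {B : G.Subgraph} {Γ : SimpleGraph W} (φ : B.coe ≃g Γ) :
    B.edgeSet.ncard = Γ.edgeSet.ncard := by
  rw [← SimpleGraph.Subgraph.image_coe_edgeSet_coe,
    Set.ncard_image_of_injective _ (Sym2.map.injective Subtype.val_injective),
    ← Nat.card_coe_set_eq, ← Nat.card_coe_set_eq]
  exact Nat.card_congr φ.mapEdgeSet

theorem ncard_edgeSet_pathP3 : pathP3.edgeSet.ncard = 2 := by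
  have : pathP3.edgeSet = ((↑) : Finset (Sym2 (Fin 3)) → Set _) {s(0, 1), s(1, 2)} := by
    ext e
    induction e using Sym2.ind with
    | _ a b =>
      rw [SimpleGraph.mem_edgeSet, SimpleGraph.pathGraph_adj, Finset.mem_coe]
      revert a b
      decide
  rw [this, Set.ncard_coe_finset]
  decide

theorem edgeSet_completeOn (V : Finset ℕ) :
    (completeOn (V : Set ℕ)).edgeSet = (V.offDiag.image Sym2.mk.uncurry : Finset (Sym2 ℕ)) := by
  ext e
  induction e using Sym2.ind with
  | _ a b =>
    simp only [completeOn, SimpleGraph.Subgraph.mem_edgeSet, SimpleGraph.Subgraph.induce_adj,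
      SimpleGraph.Subgraph.top_adj, SimpleGraph.top_adj, Finset.coe_image, Set.mem_image,
      Finset.mem_coe, Finset.mem_offDiag, Prod.exists]
    constructor
    · exact fun h => ⟨a, b, h, rfl⟩
    · rintro ⟨x, y, ⟨h1, h2, h3⟩, h⟩
      rcases Sym2.eq_iff.1 h with ⟨rfl, rfl⟩ | ⟨rfl, rfl⟩
      · exact ⟨h1, h2, h3⟩
      · exact ⟨h2, h1, h3.symm⟩

/-- The order `n` of a `P₃`-design satisfies `2 ∣ n.choose 2`. -/
theorem IsDesign.even_choose {V : Finset ℕ} {𝓑 : Set (GraphIn ℕ)}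
    (h : IsDesign (completeOn (V : Set ℕ)) pathP3 𝓑) : Even (V.card.choose 2) := by
  classical
  set E : Finset (Sym2 ℕ) := V.offDiag.image Sym2.mk.uncurry with hE
  have hE' := edgeSet_completeOn V
  -- Send each edge to its block; the nonempty fibres are the edge sets of blocks, of size two. The
  -- value `⊥` off `E` is immaterial.
  have hex : ∀ e : Sym2 ℕ, ∃ B : GraphIn ℕ, e ∈ E → B ∈ 𝓑 ∧ e ∈ B.edgeSet := by
    intro e
    by_cases he : e ∈ E
    · obtain ⟨B, hB, -⟩ := h.existsUnique_block e (by rw [hE']; exact he)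
      exact ⟨B, fun _ => hB⟩
    · exact ⟨⊥, fun h => absurd h he⟩
  choose g hg using hex
  rw [← Sym2.card_image_offDiag, ← hE, Finset.card_eq_sum_card_image g E]
  refine Finset.even_sum _ fun B hB => ?_
  obtain ⟨e₀, he₀, rfl⟩ := Finset.mem_image.1 hB
  obtain ⟨hB𝓑, -⟩ := hg e₀ he₀
  have hfib : (g e₀).edgeSet = (E.filter fun e => g e = g e₀ : Finset (Sym2 ℕ)) := by
    ext e
    rw [Finset.mem_coe, Finset.mem_filter]
    constructor
    · intro he
      have heE : e ∈ (completeOn (V : Set ℕ)).edgeSet :=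
        SimpleGraph.Subgraph.edgeSet_mono (h.le _ hB𝓑) he
      have heE' : e ∈ E := by rw [hE'] at heE; exact heE
      exact ⟨heE', (h.existsUnique_block e heE).unique (hg e heE') ⟨hB𝓑, he⟩⟩
    · rintro ⟨he, heq⟩
      exact heq ▸ (hg e he).2
  obtain ⟨φ⟩ := h.iso _ hB𝓑
  have hc := SimpleGraph.Subgraph.ncard_edgeSet_of_iso φ
  rw [ncard_edgeSet_pathP3, hfib, Set.ncard_coe_finset] at hc
  rw [hc]
  exact even_two

theorem even_choose_two_iff (n : ℕ) : Even (n.choose 2) ↔ n ≡ 0 [MOD 4] ∨ n ≡ 1 [MOD 4] := by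
  rw [Nat.choose_two_right]
  simp only [Nat.ModEq]
  obtain ⟨q, r, hr, rfl⟩ : ∃ q r, r < 4 ∧ n = 4 * q + r := ⟨n / 4, n % 4, by omega, by omega⟩
  rw [Nat.even_iff]
  have e0 : (4 * q) * (4 * q - 1) = 4 * (q * (4 * q - 1)) := by ring
  have e1 : (4 * q + 1) * (4 * q) = 4 * (q * (4 * q + 1)) := by ring
  have e2 : (4 * q + 2) * (4 * q + 1) = 4 * (4 * q * q + 3 * q) + 2 := by ring
  have e3 : (4 * q + 3) * (4 * q + 2) = 4 * (4 * q * q + 5 * q + 1) + 2 := by ring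
  interval_cases r <;> simp only [add_zero, Nat.add_succ_sub_one]
  · rw [e0]; omega
  · rw [e1]; omega
  · rw [e2]; omega
  · rw [e3]; omega

/-- All but at most one vertex of a star design belong to a `P₃`-design it is linked to. -/
theorem card_sub_one_le_of_downLink {k : ℕ} {V V' : Finset ℕ} {𝓑 𝓑' : Set (GraphIn ℕ)}
    (h : IsDesign (completeOn (V : Set ℕ)) (starGraphK k) 𝓑)
    (h' : IsDesign (completeOn (V' : Set ℕ)) pathP3 𝓑') {f : 𝓑 → 𝓑'} (hf : IsDownLink f) :
    V.card - 1 ≤ V'.card := by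
  have hcard : (V \ V').card ≤ 1 := by
    rw [Finset.card_le_one]
    intro x hx y hy
    by_contra hxy
    rw [Finset.mem_sdiff] at hx hy
    obtain ⟨B, ⟨hB, hxyB⟩, -⟩ := h.existsUnique_block s(x, y) (by
      simp only [completeOn, SimpleGraph.Subgraph.mem_edgeSet, SimpleGraph.Subgraph.induce_adj]
      exact ⟨hx.1, hy.1, by simpa using hxy⟩)
    obtain ⟨φ⟩ := h.iso B hB
    let c : B.verts := φ.symm (Sum.inl 0)
    have hc : ∀ a b, B.Adj a b → a = c ∨ b = c := by
      intro a b hab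
      have h1 : (starGraphK k).Adj (φ ⟨a, hab.fst_mem⟩) (φ ⟨b, hab.snd_mem⟩) :=
        φ.map_adj_iff.2 hab
      have key : ∀ z : B.verts, (φ z).isLeft → (z : ℕ) = c := by
        intro z hz
        obtain ⟨i, hi⟩ := Sum.isLeft_iff.1 hz
        rw [Subsingleton.elim i 0] at hi
        exact congrArg Subtype.val (φ.eq_symm_apply.2 hi)
      rcases h1 with h1 | h1
      · exact Or.inl (key _ h1.1)
      · exact Or.inr (key _ h1.2)
    have hle : (f ⟨B, hB⟩ : GraphIn ℕ) ≤ B := hf ⟨B, hB⟩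
    have hV' : (f ⟨B, hB⟩ : GraphIn ℕ) ≤ completeOn (V' : Set ℕ) := h'.le _ (f ⟨B, hB⟩).2
    obtain ⟨ψ⟩ := h'.iso _ (f ⟨B, hB⟩).2
    have hadj : (f ⟨B, hB⟩ : GraphIn ℕ).Adj (ψ.symm 0) (ψ.symm 1) := by
      have : pathP3.Adj 0 1 := by rw [SimpleGraph.pathGraph_adj]; decide
      exact ψ.symm.map_adj_iff.2 this
    -- An edge of the linked path is an edge of the star, hence meets the centre.
    have hmem : (c : ℕ) ∈ V' := by
      rcases hc _ _ (hle.2 hadj) with h1 | h1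
      · rw [← h1]; exact hV'.1 hadj.fst_mem
      · rw [← h1]; exact hV'.1 hadj.snd_mem
    rcases hc x y hxyB with h1 | h1
    · exact hx.2 (h1 ▸ hmem)
    · exact hy.2 (h1 ▸ hmem)
  have := Finset.le_card_sdiff V' V
  omega

/-! ### Construction of the down-link -/

theorem exists_downLink {k v n : ℕ} (hk : 3 < k) (hv : 2 * k + 2 ≤ v)
    (hdiv : v * (v - 1) ≡ 0 [MOD 2 * k]) (hn : v - 1 ≤ n) (heven : Even (n.choose 2)) :
    n ∈ downLinkSpectrum₁ (starGraphK k) pathP3 v := by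
  obtain ⟨D, hD, hDk, hD0, hDv⟩ := exists_tournament_dvd (by omega) hv hdiv
  choose P hPk hPd hPs using fun a => (D a).exists_partition_card (hDk a)
  -- As `k > 3`, two leaves remain after avoiding `0` and `v - 1`. Thus no reserved edge meets the
  -- sink, and those at `0` all start there.
  have hsel : ∀ L : Finset ℕ, ∃ L' : Finset ℕ, L.card = k →
      L' ⊆ L ∧ 0 ∉ L' ∧ v - 1 ∉ L' ∧ L'.card = 2 := by
    intro L
    by_cases hL : L.card = k
    · have h1 : 2 ≤ (L \ {0, v - 1}).card := by
        have h1 := Finset.le_card_sdiff {0, v - 1} L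
        have h2 : ({0, v - 1} : Finset ℕ).card ≤ 2 := Finset.card_le_two
        omega
      obtain ⟨L', hL', hc⟩ := Finset.exists_subset_card_eq h1
      refine ⟨L', fun _ => ⟨hL'.trans Finset.sdiff_subset, fun h => ?_, fun h => ?_, hc⟩⟩
      · simpa using hL' h
      · simpa using hL' h
    · exact ⟨∅, fun h => absurd h hL⟩
  choose g hg using hsel
  have hgP : ∀ {a L}, L ∈ P a → g L ⊆ L ∧ 0 ∉ g L ∧ v - 1 ∉ g L ∧ (g L).card = 2 :=
    fun {a L} hL => hg L (hPk a L hL)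
  have hPD : ∀ {a L}, L ∈ P a → L ⊆ D a :=
    fun {a L} hL => hPs a ▸ Finset.le_sup (f := id) hL
  have hgd : ∀ a, (P a : Set (Finset ℕ)).PairwiseDisjoint g := fun a =>
    (hPd a).mono_on fun L hL => (hgP hL).1
  set C : ℕ → Finset ℕ := fun a => (P a).biUnion g with hCdef
  have hCmem : ∀ {a b}, b ∈ C a → b ∈ D a ∧ b ≠ 0 ∧ b ≠ v - 1 := by
    intro a b hb
    obtain ⟨L, hL, hb⟩ := Finset.mem_biUnion.1 hb
    obtain ⟨h1, h2, h3, -⟩ := hgP hL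
    exact ⟨hPD hL (h1 hb), fun h => h2 (h ▸ hb), fun h => h3 (h ▸ hb)⟩
  have hCcard : ∀ a, (C a).card = (P a).card * 2 := fun a => by
    rw [hCdef, Finset.card_biUnion (hgd a), Finset.sum_const_nat fun L hL => (hgP hL).2.2.2]
  have hDcard : ∀ a, (D a).card = (P a).card * k := fun a => by
    rw [← hPs a, Finset.sup_eq_biUnion, Finset.card_biUnion (hPd a)]
    exact Finset.sum_const_nat (hPk a)
  have hDlt : ∀ {a b}, b ∈ D a → a + 1 < v ∧ b < v ∧ a ≠ b := by
    intro a b hb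
    obtain ⟨h1, h2, h3⟩ := hD.mem hb
    rw [Finset.mem_range] at h1 h2
    refine ⟨?_, h2, h3⟩
    by_contra hc
    rw [show a = v - 1 by omega, hDv] at hb
    exact absurd hb (Finset.notMem_empty b)
  -- every vertex other than the sink has an unused out-neighbour different from the sink
  have hfree : ∀ a, a + 1 < v → ∃ u ∈ D a, u ∉ C a ∧ u ≠ v - 1 := by
    intro a ha
    have hmem : v - 1 ∈ D a := by
      rw [hD.iff (by simp; omega) (by simp; omega) (by omega), hDv]
      exact Finset.notMem_empty a
    have hpos : 0 < (D a).card := Finset.card_pos.2 ⟨_, hmem⟩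
    have h1 : 2 ≤ (D a \ C a).card := by
      have h1 := Finset.le_card_sdiff (C a) (D a)
      rw [hDcard] at h1 hpos
      rw [hCcard] at h1
      have : 0 < (P a).card := Nat.pos_of_mul_pos_right hpos
      have : (P a).card * 4 ≤ (P a).card * k := by gcongr; omega
      omega
    obtain ⟨u, hu, hne⟩ := Finset.exists_mem_ne h1 (v - 1)
    rw [Finset.mem_sdiff] at hu
    exact ⟨u, hu.1, hu.2, hne⟩
  -- extend (or restrict) the tournament to `n` vertices
  let E₀ : ℕ → Finset ℕ := fun a => (Finset.range n).filter fun b =>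
    a < n ∧ a ≠ b ∧ (a < v ∧ b < v ∧ b ∈ D a ∨ ¬(a < v ∧ b < v) ∧ a < b)
  have hE₀ : IsTournament (Finset.range n) E₀ := by
    constructor
    · intro a b hb
      simp only [E₀, Finset.mem_filter, Finset.mem_range] at hb ⊢
      tauto
    · intro a b ha hb hab
      rw [Finset.mem_range] at ha hb
      simp only [E₀, Finset.mem_filter, Finset.mem_range]
      by_cases h : a < v ∧ b < v
      · have := hD.iff (Finset.mem_range.2 h.1) (Finset.mem_range.2 h.2) hab
        have := hab.symm
        tauto
      · have : a < b ↔ ¬ b < a := by omega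
        have := hab.symm
        tauto
  have hCE : ∀ a, C a ⊆ E₀ a := by
    intro a b hb
    obtain ⟨h1, -, h3⟩ := hCmem hb
    have := hDlt h1
    simp only [E₀, Finset.mem_filter, Finset.mem_range]
    exact ⟨by omega, by omega, this.2.2, Or.inl ⟨by omega, this.2.1, h1⟩⟩
  obtain ⟨E, hE, hCE', hEeven⟩ : ∃ E, IsTournament (Finset.range n) E ∧ (∀ a, C a ⊆ E a) ∧
      ∀ a, Even (E a).card := by
    have heven' : Even ((Finset.range n).card.choose 2) := by rwa [Finset.card_range]
    -- If the sink is present, all edges at it are free, so it is joined to every vertex.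
    by_cases hvn : v ≤ n
    · refine hE₀.exists_even hCE (w := v - 1) (by simp; omega) heven' fun x hx => ?_
      by_cases hxv : x = v - 1
      · rw [hxv]
      · refine .single ⟨hx, by simp; omega, hxv, fun h => (hCmem h).2.2 rfl, fun h => ?_⟩
        have := (hCmem h).1
        rw [hDv] at this
        exact absurd this (Finset.notMem_empty x)
    -- Now `n = v - 1`. Vertices outside `C 0` are joined to `0` by free edges. From a vertex of `C
    -- 0`, at most two free out-arcs lead out of `C 0`: by asymmetry they visit three distinct
    -- vertices, while `C 0` has two.
    · have hC0 : (C 0).card = 2 := by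
        have h1 := hDcard 0
        rw [hD0] at h1
        have : (P 0).card = 1 := Nat.eq_of_mul_eq_mul_right (by omega : 0 < k) (by omega)
        rw [hCcard, this]
      refine hE₀.exists_even hCE (w := 0) (by simp; omega) heven' fun x hx => ?_
      have hgood : ∀ y < n, y ∉ C 0 → Relation.ReflTransGen (fun a b => a ∈ Finset.range n ∧
          b ∈ Finset.range n ∧ a ≠ b ∧ b ∉ C a ∧ a ∉ C b) y 0 := by
        intro y hy hyC
        by_cases hy0 : y = 0
        · rw [hy0]
        · exact .single ⟨by simpa, by simp; omega, hy0, fun h => (hCmem h).2.1 rfl, hyC⟩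
      have hstep : ∀ y, y + 1 < v → ∃ u < n, u ∈ D y ∧ y ∈ Finset.range n ∧
          u ∈ Finset.range n ∧ y ≠ u ∧ u ∉ C y ∧ y ∉ C u := by
        intro y hy
        obtain ⟨u, hu, huC, huv⟩ := hfree y hy
        have := hDlt hu
        exact ⟨u, by omega, hu, by simp; omega, by simp; omega, this.2.2, huC,
          fun h => hD.asymm hu (hCmem h).1⟩
      rw [Finset.mem_range] at hx
      by_cases hxC : x ∈ C 0
      · obtain ⟨u, hun, hu, hxu⟩ := hstep x (by omega)
        refine .head hxu ?_
        by_cases huC : u ∈ C 0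
        · obtain ⟨t, htn, ht, hut⟩ := hstep u (by omega)
          refine .head hut (hgood t htn fun htC => ?_)
          have hxt : x ≠ t := fun h => hD.asymm hu (h ▸ ht)
          have h3 : ({x, u, t} : Finset ℕ).card ≤ (C 0).card := by
            refine Finset.card_le_card ?_
            simp [Finset.insert_subset_iff, hxC, huC, htC]
          rw [hC0, Finset.card_eq_three.2 ⟨x, u, t, (hDlt hu).2.2, hxt, (hDlt ht).2.2, rfl⟩] at h3
          omega
        · exact hgood u hun huC
      · exact hgood x hx hxC
  -- Both `E a` and `C a` have even size, so the unreserved out-neighbours split into pairs.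
  choose R hR2 hRd hRs using fun a => (E a \ C a).exists_partition_card (k := 2) (by
    rw [Finset.card_sdiff_of_subset (hCE' a)]
    exact Nat.dvd_sub (hEeven a).two_dvd ⟨(P a).card, by rw [hCcard, mul_comm]⟩)
  have hnotD : ∀ a, a ∉ D a := fun a h => (hD.mem h).2.2 rfl
  have hnotE : ∀ a, a ∉ E a := fun a h => (hE.mem h).2.2 rfl
  let Q : ℕ → Finset (Finset ℕ) := fun a => (P a).image g ∪ R a
  have hQ2 : ∀ a, ∀ L ∈ Q a, L.card = 2 := by
    intro a L hL
    rcases Finset.mem_union.1 hL with hL | hL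
    · obtain ⟨L₀, hL₀, rfl⟩ := Finset.mem_image.1 hL
      exact (hgP hL₀).2.2.2
    · exact hR2 a L hL
  have hQs : ∀ a, (Q a).sup id = E a := by
    intro a
    rw [Finset.sup_union, hRs, Finset.sup_image, Function.id_comp, Finset.sup_eq_biUnion]
    exact Finset.union_sdiff_of_subset (hCE' a)
  have hQd : ∀ a, (Q a : Set (Finset ℕ)).PairwiseDisjoint id := by
    intro a
    rw [Finset.coe_union, Set.pairwiseDisjoint_union]
    refine ⟨?_, hRd a, ?_⟩
    · rw [Finset.coe_image]
      rintro _ ⟨L, hL, rfl⟩ _ ⟨L', hL', rfl⟩ hne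
      exact hgd a hL hL' fun h => hne (h ▸ rfl)
    · intro L hL L' hL' _
      obtain ⟨L₀, hL₀, rfl⟩ := Finset.mem_image.1 hL
      have h1 : g L₀ ⊆ C a := Finset.subset_biUnion_of_mem g hL₀
      have h2 : L' ⊆ E a \ C a := hRs a ▸ Finset.le_sup (f := id) hL'
      exact Finset.disjoint_of_subset_left h1 (Finset.disjoint_sdiff.mono_right h2)
  refine ⟨Finset.range v, Finset.range n, _, _, Finset.card_range v, Finset.card_range n,
    hD.isDesign (Q := P) (fun a L hL => starBlock_iso (fun h => hnotD a (hPD hL h)) (hPk a L hL))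
      (fun a L hL => Finset.card_pos.1 (by rw [hPk a L hL]; omega)) hPd hPs,
    hE.isDesign (Q := Q) (fun a L hL => starBlock_iso_path (fun h => hnotE a
        (by rw [← hQs a]; exact Finset.le_sup (f := id) hL h)) (hQ2 a L hL))
      (fun a L hL => Finset.card_pos.1 (by rw [hQ2 a L hL]; omega)) hQd hQs, ?_⟩
  have hlink : ∀ B : {B | ∃ a, ∃ L ∈ P a, B = starBlock a L},
      ∃ B' : {B | ∃ a, ∃ L ∈ Q a, B = starBlock a L}, (B' : GraphIn ℕ) ≤ B := by
    rintro ⟨_, a, L, hL, rfl⟩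
    exact ⟨⟨_, a, g L, Finset.mem_union_left _ (Finset.mem_image_of_mem g hL), rfl⟩,
      starBlock_mono (hgP hL).1⟩
  exact ⟨fun B => (hlink B).choose, fun B => (hlink B).choose_spec⟩

theorem mainTheorem4 (k v : ℕ) (hk : 3 < k) (hv : 4 * k ≤ v)
    (hdiv : v * (v - 1) ≡ 0 [MOD 2 * k]) :
    downLinkSpectrum₁ (starGraphK k) pathP3 v =
      {n : ℕ | v - 1 ≤ n ∧ (n ≡ 0 [MOD 4] ∨ n ≡ 1 [MOD 4])} := by
  ext n
  constructor
  · rintro ⟨V, V', 𝓑, 𝓑', rfl, rfl, h, h', f, hf⟩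
    exact ⟨card_sub_one_le_of_downLink h h' hf, (even_choose_two_iff _).1 h'.even_choose⟩
  · rintro ⟨hn, hmod⟩
    exact exists_downLink hk (by omega) hdiv hn ((even_choose_two_iff n).2 hmod)
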